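/- Let $N,K\ge 1$. Let $f:\mathbb R^N\times\mathbb R\to\mathbb R^N$ (drift, measurable in the state), $g:\mathbb R\to\mathbb R$ (diffusion coefficient), $r:\mathbb R^N\to\mathbb R$ (reward) and $c:\mathbb R^N\times\mathbb R\to\mathbb R^N$ (denoising map) be given. Put $\mathrm{proj}(v)=\sqrt N\,v/\|v\|$, let $\mathrm{Unif}(\sqrt N\,\mathbb S^{N-1})$ be the uniform distribution on the sphere of radius $\sqrt N$, and for a state $x$, noise $z$, time $t$ and step $\Delta$ put $$\mathrm{EM}_{f,g}(x,z,t,\Delta)=x-f(x,t)\Delta+g(t)\sqrt\Delta\,z,$$ $$\mathrm{heun}_{f,g}(x,z,t,\Delta)=x-\tfrac12\bigl[f(x,t)+f(\mathrm{EM}_{f,g}(x,z,t,\Delta),t-\Delta)\bigr]\Delta+\tfrac12\bigl[g(t)+g(t-\Delta)\bigr]\sqrt\Delta\,z .$$ A step of *SDE sampling* moves $x$ to $\mathrm{heun}_{f,g}(x,z,t,\Delta)$ with $z\sim\mathcal N(0,I_N)$ (independent from step to step). A step of *Boltzmann Demon sampling* at temperature $\tau$ draws i.i.d. $z_1,\dots,z_K\sim\mathcal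 N(0,I_N)$ (independent from step to step), computes $R_k=r\bigl(c(\mathrm{heun}_{f,g}(x,z_k,t,\Delta),t-\Delta)\bigr)$ and $b_k=e^{R_k/\tau}\big/\bigl(\frac1K\sum_{j}e^{R_j/\tau}\bigr)$, and moves $x$ to $\mathrm{heun}_{f,g}(x,z^*,t,\Delta)$ with $z^*=\mathrm{proj}\bigl(\sum_k b_kz_k\bigr)$. Here $R/\tau=0$ for $\tau=\infty$. All samplings start from a fixed state. Then: 1. For $\tau=\infty$ all weights are $b_k=1$, and for fixed rewards the weights at finite $\tau$ converge to these as $\tau\to\infty$. 2. $\sum_{k=1}^K z_k\sim\mathcal N(0,K I_N)$, and $\mathrm{proj}\bigl(\sum_k z_k\bigr)$ has, like $\mathrm{proj}(z)$ for a single $z\sim\mathcal N(0,I_N)$, the distribution $\mathrm{Unif}(\sqrt N\,\mathbb S^{N-1})$. 3. For every time grid and every initial state, the whole trajectory of Boltzmann Demon sampling with $\tau=\infty$ has the same distribution as the trajectory of SDE sampling in which each Gaussian noise $z$ is replaced by $\mathrm{proj}(z)$, and as the one in which the noises are i.i.d. $\mathrm{Unif}(\sqrt N\,\mathbb S^{N-1})$.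 4. If $\tilde z_1,\tilde z_2,\dots$ are i.i.d. $\mathrm{Unif}(\sqrt N\,\mathbb S^{N-1})$ and $z\sim\mathcal N(0,I_N)$, then $\frac1{\sqrt n}\sum_{i=1}^n\tilde z_i\to z$ in distribution as $n\to\infty$. Consequently, for every $a\in\mathbb R^N$, $\sigma\in\mathbb R$ and $\Delta>0$, $$-a\Delta+\sum_{i=1}^n\sigma\sqrt{\tfrac{\Delta}{n}}\;\tilde z_i\ \longrightarrow\ -a\Delta+\sigma\sqrt\Delta\,z\quad\text{in distribution.}$$ 5. Let $x\in\mathbb R^N$, $t\in\mathbb R$, $\Delta>0$, and keep the coefficients constant, equal to $f(x,t)$ and $g(t)$, between the times $t$ and $t-\Delta$. The result of $n$ steps of size $\Delta/n$ of Boltzmann Demon sampling with $\tau=\infty$, started from $x$, converges in distribution as $n\to\infty$ to the Gaussian Euler–Maruyama step $\mathrm{EM}_{f,g}(x,z,t,\Delta)$, $z\sim\mathcal N(0,I_N)$, and to the solution $x-f(x,t)\Delta+g(t)W_\Delta$ of the SDE, where $W$ is a standard $N$-dimensional Brownian motion. Both limits have the same distribution as the result of SDE sampling (with the same constant coefficients)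 with $n$ steps of size $\Delta/n$, for any $n\ge1$. -/

import Mathlib

open MeasureTheory ProbabilityTheory Filter
open scoped Topology NNReal

noncomputable section

/-- The state space `ℝ^N` with its Euclidean norm. -/
abbrev E (N : ℕ) : Type := EuclideanSpace ℝ (Fin N)

/-- Projection of a nonzero vector onto the sphere of radius `√N`:
`√N · normalized(v)` with `normalized(v) = v / ‖v‖`. -/
def projSphere {N : ℕ} (v : E N) : E N := √(N : ℝ) • (‖v‖⁻¹ • v)

/-- The uniform probability measure on the sphere of radius `√N` in `ℝ^N`: the normalised surface
measure of the unit sphere, pushed forward by `u ↦ √N u`. -/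
def uniformSphere (N : ℕ) : Measure (E N) :=
  (((volume : Measure (E N)).toSphere Set.univ)⁻¹ • (volume : Measure (E N)).toSphere).map
    (fun u : Metric.sphere (0 : E N) 1 => √(N : ℝ) • (u : E N))

/-- One backward Euler-Maruyama step of size `Δ` from the state `x` at time `t`, seeded by `z`. -/
def eulerMaruyama {N : ℕ} (f : E N → ℝ → E N) (g : ℝ → ℝ) (x z : E N) (t Δ : ℝ) : E N :=
  x - Δ • f x t + (g t * √Δ) • z

/-- One backward stochastic Heun step of size `Δ` from the state `x` at time `t`, seeded by `z`. -/
def heun {N : ℕ} (f : E N → ℝ → E N) (g : ℝ → ℝ) (x z : E N) (t Δ : ℝ) : E N :=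
  x - (1 / 2 : ℝ) • Δ • (f x t + f (eulerMaruyama f g x z t Δ) (t - Δ))
    + ((1 / 2 : ℝ) * (g t + g (t - Δ)) * √Δ) • z

/-- The Boltzmann weights `b_k = exp(R_k / τ) / Z` with `Z = (1 / K) ∑_j exp(R_j / τ)`. The
temperature may be `τ = ∞`, in which case `R / ∞ = 0`. -/
def boltzmannWeights {K : ℕ} (τ : EReal) (R : Fin K → ℝ) (k : Fin K) : ℝ :=
  Real.exp ((R k : EReal) / τ).toReal
    / ((1 / (K : ℝ)) * ∑ j, Real.exp ((R j : EReal) / τ).toReal)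

/-- The noise `z* = √N normalized(∑_k b_k z_k)` of a Boltzmann Demon step, where `b` are the
Boltzmann weights of the rewards `R_k = r(c(x_k, t - Δ))` of the candidates
`x_k = heun(x, z_k, t, Δ)`. -/
def boltzmannNoise {N K : ℕ} (f : E N → ℝ → E N) (g : ℝ → ℝ) (r : E N → ℝ) (c : E N → ℝ → E N)
    (τ : EReal) (x : E N) (z : Fin K → E N) (t Δ : ℝ) : E N :=
  projSphere
    (∑ k, boltzmannWeights τ (fun j => r (c (heun f g x (z j) t Δ) (t - Δ))) k • z k)

/-- Boltzmann Demon sampling from `x` along the (decreasing) time grid `t 0, t 1, …`; step `i`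
uses the candidate noises `z i 0, …, z i (K - 1)`. -/
def boltzmannDemon {N K : ℕ} (f : E N → ℝ → E N) (g : ℝ → ℝ) (r : E N → ℝ) (c : E N → ℝ → E N)
    (τ : EReal) (t : ℕ → ℝ) (x : E N) (z : ℕ → Fin K → E N) : ℕ → E N
  | 0 => x
  | i + 1 =>
    let y := boltzmannDemon f g r c τ t x z i
    heun f g y (boltzmannNoise f g r c τ y (z i) (t i) (t i - t (i + 1))) (t i) (t i - t (i + 1))

/-- SDE sampling from `x` along the (decreasing) time grid `t 0, t 1, …`; step `i` is seeded by the
noise `w i`. -/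
def sdeSampling {N : ℕ} (f : E N → ℝ → E N) (g : ℝ → ℝ) (t : ℕ → ℝ) (x : E N) (w : ℕ → E N) :
    ℕ → E N
  | 0 => x
  | i + 1 => heun f g (sdeSampling f g t x w i) (w i) (t i) (t i - t (i + 1))

/-- `W` is a standard `N`-dimensional Brownian motion, given by its coordinates: they are
independent real Brownian motions. -/
structure IsBrownian {N : ℕ} {Ω : Type*} [MeasurableSpace Ω] (W : Fin N → ℝ≥0 → Ω → ℝ)
    (P : Measure Ω) : Prop where
  isBrownianReal : ∀ i, IsBrownianReal (W i) P
  indep : iIndepFun (fun i ω s => W i s ω) P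

/-- The solution, run backwards in time for a duration `s` from the state `x`, of the SDE
`dx = a dt + σ dW` with constant drift `a` and constant diffusion coefficient `σ`. -/
def constSDE {N : ℕ} {Ω : Type*} (x a : E N) (σ : ℝ) (W : Fin N → ℝ≥0 → Ω → ℝ) (s : ℝ≥0)
    (ω : Ω) : E N :=
  x - (s : ℝ) • a + σ • WithLp.toLp 2 (fun i => W i s ω)

end

/-! At infinite temperature all weights are one, so the Demon noise is `projSphere (∑ k, z i k)`.
The sum is `√K` times a standard Gaussian, and `projSphere` ignores positive factors. The direction
of a Gaussian is uniform because its density is radial and splits off in polar coordinates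
(`map_projSphere_stdGaussian`). Hence the noises are i.i.d. uniform on the sphere, and a trajectory
is one measurable function of the noise sequence, so its law depends only on the law of that
sequence. The radius `√N` makes the covariance of the uniform law the identity: rotation invariance
equates all directional variances, and the squared norm `N` fixes their sum. The central limit
theorem (`tendstoInDistribution_inv_sqrt_smul_sum`) then has a standard Gaussian limit. With
constant coefficients a trajectory is affine in the sum of its noises (`sdeSampling_const`), so the
continuous mapping theorem gives the convergence of the sampler. -/

section SphereAndGaussian

open scoped ENNReal RealInnerProductSpace

/-! ### Polar coordinates and the uniform law on the sphere. -/

lemma lintegral_norm_mul_normalized {F : Type*} [NormedAddCommGroup F] [NormedSpace ℝ F]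
    [FiniteDimensional ℝ F] [Nontrivial F] [MeasurableSpace F] [BorelSpace F] (μ : Measure F)
    [μ.IsAddHaarMeasure] {h : ℝ → ℝ≥0∞} (hh : Measurable h) {G : F → ℝ≥0∞} (hG : Measurable G) :
    ∫⁻ x, h ‖x‖ * G (‖x‖⁻¹ • x) ∂μ =
      (∫⁻ u, G u ∂μ.toSphere) *
        ∫⁻ s, h s ∂(Measure.volumeIoiPow (Module.finrank ℝ F - 1)) := by
  have hms : MeasurableSet ({0}ᶜ : Set F) := (measurableSet_singleton _).compl
  calc ∫⁻ x, h ‖x‖ * G (‖x‖⁻¹ • x) ∂μ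
      = ∫⁻ x in ({0}ᶜ : Set F), h ‖x‖ * G (‖x‖⁻¹ • x) ∂μ := by
        rw [restrict_compl_singleton]
    _ = ∫⁻ x : ({0}ᶜ : Set F), h ‖(x : F)‖ * G (‖(x : F)‖⁻¹ • (x : F)) ∂(μ.comap (↑)) :=
        (lintegral_subtype_comap hms _).symm
    _ = ∫⁻ p, G p.1 * h p.2 ∂(μ.toSphere.prod
          (Measure.volumeIoiPow (Module.finrank ℝ F - 1))) := by
        rw [← μ.measurePreserving_homeomorphUnitSphereProd.lintegral_comp (by fun_prop)]
        refine lintegral_congr fun x => ?_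
        simp [mul_comm]
    _ = _ := lintegral_prod_mul (f := fun u : Metric.sphere (0 : F) 1 => G u)
        (g := fun s : Set.Ioi (0 : ℝ) => h s) (by fun_prop) (by fun_prop)

/-- Polar integration needs a density. Both sides are finite measures, so comparing characteristic
functions suffices. -/
lemma stdGaussian_eq_withDensity (F : Type*) [NormedAddCommGroup F] [InnerProductSpace ℝ F]
    [FiniteDimensional ℝ F] [MeasurableSpace F] [BorelSpace F] :
    stdGaussian F = (volume : Measure F).withDensity
      (fun x => ENNReal.ofReal (((2 * Real.pi) ^ (Module.finrank ℝ F / 2 : ℝ))⁻¹ *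
        Real.exp (-(1 / 2) * ‖x‖ ^ 2))) := by
  have hint : Integrable (fun x : F => ((2 * Real.pi) ^ (Module.finrank ℝ F / 2 : ℝ))⁻¹ *
      Real.exp (-(1 / 2) * ‖x‖ ^ 2)) := by
    -- A non-integrable function has integral zero by convention, so a nonzero integral proves
    -- integrability.
    refine Integrable.const_mul (Integrable.of_integral_ne_zero ?_) _
    rw [GaussianFourier.integral_rexp_neg_mul_sq_norm (by norm_num)]
    positivity
  have : IsFiniteMeasure ((volume : Measure F).withDensity
      (fun x => ENNReal.ofReal (((2 * Real.pi) ^ (Module.finrank ℝ F / 2 : ℝ))⁻¹ *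
        Real.exp (-(1 / 2) * ‖x‖ ^ 2)))) := isFiniteMeasure_withDensity_ofReal hint.2
  refine Measure.ext_of_charFun (funext fun t => ?_)
  rw [charFun_stdGaussian, charFun_apply, integral_withDensity_eq_integral_toReal_smul
    (by fun_prop) (by simp)]
  have h1 : ∀ x : F, (ENNReal.ofReal (((2 * Real.pi) ^ (Module.finrank ℝ F / 2 : ℝ))⁻¹ *
      Real.exp (-(1 / 2) * ‖x‖ ^ 2))).toReal • Complex.exp (⟪x, t⟫ * Complex.I) =
      (((2 * Real.pi) ^ (Module.finrank ℝ F / 2 : ℝ) : ℝ) : ℂ)⁻¹ *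
        Complex.exp (-((1 / 2 : ℝ) : ℂ) * ‖x‖ ^ 2 + Complex.I * ⟪t, x⟫) := by
    intro x
    rw [ENNReal.toReal_ofReal (by positivity), Complex.real_smul, Complex.exp_add,
      real_inner_comm]
    push_cast
    ring_nf
  simp_rw [h1]
  rw [integral_const_mul, GaussianFourier.integral_cexp_neg_mul_sq_norm_add (by norm_num)]
  have h2 : (Real.pi / ((1 / 2 : ℝ) : ℂ)) ^ (Module.finrank ℝ F / 2 : ℂ) =
      (((2 * Real.pi) ^ (Module.finrank ℝ F / 2 : ℝ) : ℝ) : ℂ) := by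
    rw [Complex.ofReal_cpow (by positivity)]
    push_cast
    congr 1
    ring
  rw [h2, inv_mul_cancel_left₀]
  · simp only [Complex.I_sq]
    push_cast
    ring_nf
  · exact_mod_cast (by positivity : ((2 * Real.pi) ^ (Module.finrank ℝ F / 2 : ℝ) : ℝ) ≠ 0)

lemma measurable_projSphere {N : ℕ} : Measurable (projSphere : E N → E N) := by
  unfold projSphere; fun_prop

/-- The direction of a standard Gaussian vector is uniform on the sphere. -/
lemma map_projSphere_stdGaussian {N : ℕ} (hN : 0 < N) :
    (stdGaussian (E N)).map projSphere = uniformSphere N := by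
  have : Nonempty (Fin N) := ⟨⟨0, hN⟩⟩
  set ρ := Measure.volumeIoiPow (Module.finrank ℝ (E N) - 1)
  set σ := (volume : Measure (E N)).toSphere
  set h : ℝ → ℝ≥0∞ := fun s => ENNReal.ofReal
    (((2 * Real.pi) ^ (Module.finrank ℝ (E N) / 2 : ℝ))⁻¹ * Real.exp (-(1 / 2) * s ^ 2))
  have hh : Measurable h := by fun_prop
  have key : ∀ G : E N → ℝ≥0∞, Measurable G →
      ∫⁻ x, G (‖x‖⁻¹ • x) ∂(stdGaussian (E N)) = (∫⁻ u, G u ∂σ) * ∫⁻ s, h s ∂ρ := by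
    intro G hG
    rw [stdGaussian_eq_withDensity, lintegral_withDensity_eq_lintegral_mul _ (by fun_prop)
      (by fun_prop), ← lintegral_norm_mul_normalized volume hh hG]
    rfl
  -- Testing with `G = 1` identifies the radial integral as the inverse of the total surface
  -- measure, without evaluating either.
  have hone : σ Set.univ * ∫⁻ s, h s ∂ρ = 1 := by
    simpa using (key (fun _ => 1) measurable_const).symm
  have hC : ∫⁻ s, h s ∂ρ = (σ Set.univ)⁻¹ := ENNReal.eq_inv_of_mul_eq_one_left (by rwa [mul_comm])
  refine Measure.ext_of_lintegral _ fun φ hφ => ?_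
  rw [lintegral_map hφ measurable_projSphere, uniformSphere, lintegral_map hφ (by fun_prop),
    lintegral_smul_measure, smul_eq_mul, ← hC, mul_comm]
  exact key (fun x => φ (√(N : ℝ) • x)) (by fun_prop)

lemma isProbabilityMeasure_uniformSphere {N : ℕ} (hN : 0 < N) :
    IsProbabilityMeasure (uniformSphere N) := by
  rw [← map_projSphere_stdGaussian hN]
  exact Measure.isProbabilityMeasure_map measurable_projSphere.aemeasurable

/-- Inherited from the Gaussian, since linear isometries commute with `projSphere`. -/
lemma map_uniformSphere_linearIsometryEquiv {N : ℕ} (hN : 0 < N) (e : E N ≃ₗᵢ[ℝ] E N) :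
    (uniformSphere N).map e = uniformSphere N := by
  have hcomm : e ∘ projSphere = projSphere ∘ e := by
    ext1 x
    simp [projSphere]
  rw [← map_projSphere_stdGaussian hN, Measure.map_map (by fun_prop) measurable_projSphere, hcomm,
    ← Measure.map_map measurable_projSphere (by fun_prop), stdGaussian_map]

lemma norm_eq_ae_uniformSphere {N : ℕ} : ∀ᵐ y ∂(uniformSphere N), ‖y‖ = √(N : ℝ) := by
  refine (ae_map_iff (by fun_prop) (measurableSet_eq_fun (by fun_prop) (by fun_prop))).2 ?_
  exact ae_of_all _ fun u => by simp [norm_smul, abs_of_nonneg]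

lemma integrable_inner_pow_uniformSphere {N : ℕ} (hN : 0 < N) (t : E N) (m : ℕ) :
    Integrable (fun y => ⟪y, t⟫ ^ m) (uniformSphere N) := by
  have := isProbabilityMeasure_uniformSphere hN
  refine Integrable.of_bound (C := (√(N : ℝ) * ‖t‖) ^ m) (by fun_prop) ?_
  filter_upwards [norm_eq_ae_uniformSphere (N := N)] with y hy
  rw [norm_pow, ← hy]
  gcongr
  exact norm_inner_le_norm y t

lemma integral_inner_uniformSphere {N : ℕ} (hN : 0 < N) (t : E N) :
    ∫ y, ⟪y, t⟫ ∂(uniformSphere N) = 0 := by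
  have h : ∫ y, ⟪y, t⟫ ∂(uniformSphere N) = -∫ y, ⟪y, t⟫ ∂(uniformSphere N) := by
    conv_lhs => rw [← map_uniformSphere_linearIsometryEquiv hN (LinearIsometryEquiv.neg ℝ)]
    rw [integral_map (by fun_prop) (by fun_prop), ← integral_neg]
    simp
  linarith

/-- The reflection in the hyperplane orthogonal to `s - t` exchanges the two vectors. -/
lemma integral_inner_sq_uniformSphere_eq_of_norm_eq {N : ℕ} (hN : 0 < N) {s t : E N}
    (hst : ‖s‖ = ‖t‖) :
    ∫ y, ⟪y, s⟫ ^ 2 ∂(uniformSphere N) = ∫ y, ⟪y, t⟫ ^ 2 ∂(uniformSphere N) := by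
  set e := (Submodule.span ℝ {s - t})ᗮ.reflection
  have he : e s = t := Submodule.reflection_sub hst
  conv_rhs => rw [← map_uniformSphere_linearIsometryEquiv hN e]
  rw [integral_map (by fun_prop) (by fun_prop), ← he]
  simp

/-- The uniform distribution on the sphere of radius `√N` has identity covariance. -/
lemma integral_inner_sq_uniformSphere {N : ℕ} (hN : 0 < N) (t : E N) :
    ∫ y, ⟪y, t⟫ ^ 2 ∂(uniformSphere N) = ‖t‖ ^ 2 := by
  have := isProbabilityMeasure_uniformSphere hN
  let b := EuclideanSpace.basisFun (Fin N) ℝ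
  -- The basis vectors are rescaled to the norm of `t`, so every summand equals the wanted integral;
  -- Parseval and `‖y‖ ^ 2 = N` give the sum.
  have hsum : ∑ i, ∫ y, ⟪y, ‖t‖ • b i⟫ ^ 2 ∂(uniformSphere N) = N * ‖t‖ ^ 2 := by
    rw [← integral_finsetSum _ fun i _ => integrable_inner_pow_uniformSphere hN _ 2]
    have : ∀ᵐ y ∂(uniformSphere N), ∑ i, ⟪y, ‖t‖ • b i⟫ ^ 2 = N * ‖t‖ ^ 2 := by
      filter_upwards [norm_eq_ae_uniformSphere (N := N)] with y hy
      simp_rw [inner_smul_right, mul_pow]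
      rw [← Finset.mul_sum, b.sum_sq_inner_left, hy, Real.sq_sqrt (by positivity), mul_comm]
    rw [integral_congr_ae this]
    simp
  have heq : ∀ i, ∫ y, ⟪y, ‖t‖ • b i⟫ ^ 2 ∂(uniformSphere N)
      = ∫ y, ⟪y, t⟫ ^ 2 ∂(uniformSphere N) := fun i =>
    integral_inner_sq_uniformSphere_eq_of_norm_eq hN (by simp [norm_smul])
  simp_rw [heq] at hsum
  simp only [Finset.sum_const, Finset.card_univ, Fintype.card_fin, nsmul_eq_mul] at hsum
  exact mul_left_cancel₀ (by positivity) hsum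

/-! ### Central limit theorem, convergence in law and independence. -/

section General

variable {F : Type*} [NormedAddCommGroup F] [InnerProductSpace ℝ F] [FiniteDimensional ℝ F]
  [MeasurableSpace F] [BorelSpace F] {Ω Ω' : Type*} [MeasurableSpace Ω] [MeasurableSpace Ω']
  {P : Measure Ω} {P' : Measure Ω'}

/-- Multivariate central limit theorem for centered random vectors with identity covariance. -/
theorem tendstoInDistribution_inv_sqrt_smul_sum [IsProbabilityMeasure P] [IsProbabilityMeasure P']
    {X : ℕ → Ω → F} {Z : Ω' → F} {μ : Measure F} (hX : ∀ i, HasLaw (X i) μ P)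
    (hindep : iIndepFun X P) (hmean : ∀ t, ∫ y, ⟪y, t⟫ ∂μ = 0)
    (hcov : ∀ t, ∫ y, ⟪y, t⟫ ^ 2 ∂μ = ‖t‖ ^ 2) (hZ : HasLaw Z (stdGaussian F) P') :
    TendstoInDistribution (fun (n : ℕ) ω => (√(n : ℝ))⁻¹ • ∑ i ∈ Finset.range n, X i ω)
      atTop Z (fun _ => P) P' where
  forall_aemeasurable n :=
    (Finset.aemeasurable_fun_sum _ fun i _ => (hX i).aemeasurable).const_smul _
  aemeasurable_limit := hZ.aemeasurable
  tendsto := by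
    have : IsProbabilityMeasure μ := (hX 0).isProbabilityMeasure_iff.1 ‹_›
    refine ProbabilityMeasure.tendsto_iff_tendsto_charFun.2 fun t => ?_
    rw! [hZ.map_eq]
    simp only [ProbabilityMeasure.coe_mk]
    have hcf : ∀ n : ℕ, charFun (P.map
        (fun ω => (√(n : ℝ))⁻¹ • ∑ i ∈ Finset.range n, X i ω)) t =
        charFun μ ((√(n : ℝ))⁻¹ • t) ^ n := by
      intro n
      rw [charFun_map_smul_comp, (hindep.restrict _).charFun_map_fun_finsetSum_eq_prod
        fun i _ => (hX i).aemeasurable]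
      · simp [fun i => (hX i).map_eq]
      · exact Finset.aemeasurable_fun_sum _ fun i _ => (hX i).aemeasurable
    simp_rw [hcf, charFun_stdGaussian]
    rcases eq_or_ne t 0 with rfl | ht
    · simp
    have hn : ‖t‖ ≠ 0 := norm_ne_zero_iff.2 ht
    -- Reduction to dimension one: the projection on the unit vector along `t` has mean 0 and
    -- variance 1, and its characteristic function is taken at multiples of `‖t‖`.
    have hlim := tendsto_charFun_inv_sqrt_mul_pow (P := μ)
      (X := fun y => ⟪y, ‖t‖⁻¹ • t⟫) (by fun_prop) (hmean _)
      ((hcov _).trans (by simp [norm_smul, hn])) ‖t‖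
    convert hlim using 3 with n
    · rw [charFun_apply, charFun_apply_real, integral_map (by fun_prop) (by fun_prop)]
      refine integral_congr_ae (ae_of_all _ fun y => ?_)
      simp only [inner_smul_right]
      have hn' : (‖t‖ : ℂ) ≠ 0 := by exact_mod_cast hn
      push_cast
      field_simp

lemma MeasureTheory.TendstoInDistribution.congr_eventually {G : Type*} [TopologicalSpace G] [MeasurableSpace G]
    [OpensMeasurableSpace G] {ι : Type*} {l : Filter ι} [IsProbabilityMeasure P]
    [IsProbabilityMeasure P'] {X Y : ι → Ω → G} {Z : Ω' → G}
    (h : TendstoInDistribution X l Z (fun _ => P) P') (hY : ∀ i, AEMeasurable (Y i) P)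
    (hXY : ∀ᶠ i in l, X i = Y i) : TendstoInDistribution Y l Z (fun _ => P) P' where
  forall_aemeasurable := hY
  aemeasurable_limit := h.aemeasurable_limit
  tendsto := by
    refine h.tendsto.congr' ?_
    filter_upwards [hXY] with i hi
    exact Subtype.ext (congrArg (fun V => P.map V) hi)

lemma MeasureTheory.TendstoInDistribution.of_identDistrib_limit {G : Type*} [TopologicalSpace G]
    [MeasurableSpace G] [OpensMeasurableSpace G] {ι : Type*} {l : Filter ι}
    {Ω'' : Type*} [MeasurableSpace Ω''] {P'' : Measure Ω''}
    [IsProbabilityMeasure P] [IsProbabilityMeasure P'] [IsProbabilityMeasure P'']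
    {X : ι → Ω → G} {Z : Ω' → G} {T : Ω'' → G}
    (h : TendstoInDistribution X l Z (fun _ => P) P') (hZT : IdentDistrib Z T P' P'') :
    TendstoInDistribution X l T (fun _ => P) P'' where
  forall_aemeasurable := h.forall_aemeasurable
  aemeasurable_limit := hZT.aemeasurable_snd
  tendsto := by
    have := h.tendsto
    rw! [hZT.map_eq] at this
    exact this

/-- The joint law is a product over pairs; currying turns it into a product over `i` of the row
laws. -/
lemma ProbabilityTheory.iIndepFun.of_uncurry {ι κ G : Type*} [Countable ι] [Countable κ] [MeasurableSpace G]
    [IsProbabilityMeasure P] {X : ι → κ → Ω → G} (hX : ∀ i k, AEMeasurable (X i k) P)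
    (h : iIndepFun (fun p : ι × κ => X p.1 p.2) P) :
    iIndepFun (fun i ω k => X i k ω) P := by
  have hprob : ∀ i k, IsProbabilityMeasure (P.map (X i k)) := fun i k =>
    Measure.isProbabilityMeasure_map (hX i k)
  have hrow : ∀ i, iIndepFun (X i) P := fun i =>
    h.precomp (g := fun k => (i, k)) (Prod.mk_right_injective i)
  rw [iIndepFun_iff_map_fun_eq_infinitePi_map₀' fun i => aemeasurable_pi_lambda _ (hX i)]
  simp_rw [fun i => (hrow i).map_fun_eq_infinitePi_map₀' (hX i)]
  rw [← Measure.infinitePi_map_curry (fun i k => P.map (X i k)),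
    ← iIndepFun.map_fun_eq_infinitePi_map₀' (fun p : ι × κ => hX p.1 p.2) h,
    AEMeasurable.map_map_of_aemeasurable (by fun_prop)
      (aemeasurable_pi_lambda _ fun p : ι × κ => hX p.1 p.2)]
  rfl

/-- A normalised sum of independent standard Gaussian vectors is a standard Gaussian vector. -/
lemma hasLaw_inv_sqrt_card_smul_sum_stdGaussian {ι : Type*} {s : Finset ι} (hs : s.Nonempty)
    {X : ι → Ω → F} (hX : ∀ i ∈ s, HasLaw (X i) (stdGaussian F) P)
    (hindep : iIndepFun (s.restrict X) P) :
    HasLaw (fun ω => (√(s.card : ℝ))⁻¹ • ∑ i ∈ s, X i ω) (stdGaussian F) P where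
  aemeasurable := (Finset.aemeasurable_fun_sum _ fun i hi => (hX i hi).aemeasurable).const_smul _
  map_eq := by
    have : IsProbabilityMeasure P := hindep.isProbabilityMeasure
    have hm := Finset.aemeasurable_fun_sum s fun i hi => (hX i hi).aemeasurable
    have := Measure.isProbabilityMeasure_map (hm.const_smul (√(s.card : ℝ))⁻¹)
    refine Measure.ext_of_charFun (funext fun t => ?_)
    rw [charFun_map_smul_comp hm, hindep.charFun_map_fun_finsetSum_eq_prod
      fun i hi => (hX i hi).aemeasurable, Finset.prod_apply,
      Finset.prod_congr rfl fun i hi => by rw [(hX i hi).map_eq]]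
    have hc : (s.card : ℝ) ≠ 0 := by exact_mod_cast hs.card_pos.ne'
    simp only [charFun_stdGaussian, Finset.prod_const, ← Complex.exp_nat_mul]
    congr 1
    norm_cast
    rw [norm_smul, mul_pow, norm_inv, Real.norm_of_nonneg (Real.sqrt_nonneg _), inv_pow,
      Real.sq_sqrt (by positivity)]
    field_simp

end General

/-! ### Scaling of Gaussian vectors and Brownian motion at a fixed time. -/

lemma map_smul_stdGaussian {N : ℕ} {c : ℝ} (hc : 0 ≤ c) :
    (stdGaussian (E N)).map (fun x => √c • x) =
      multivariateGaussian 0 (c • (1 : Matrix (Fin N) (Fin N) ℝ)) := by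
  refine Measure.ext_of_charFun (funext fun t => ?_)
  rw [charFun_map_smul, charFun_stdGaussian,
    charFun_multivariateGaussian (Matrix.PosSemidef.one.smul hc), Matrix.smul_mulVec,
    Matrix.one_mulVec, dotProduct_smul]
  have : t.ofLp ⬝ᵥ t.ofLp = ‖t‖ ^ 2 := by
    rw [EuclideanSpace.real_norm_sq_eq]
    simp [dotProduct, sq]
  rw [this, ← Complex.ofReal_pow, norm_smul, Real.norm_of_nonneg (Real.sqrt_nonneg _), mul_pow,
    Real.sq_sqrt hc]
  simp [neg_div]

lemma projSphere_smul {N : ℕ} {c : ℝ} (hc : 0 < c) (v : E N) :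
    projSphere (c • v) = projSphere v := by
  simp only [projSphere, norm_smul, Real.norm_of_nonneg hc.le, smul_smul, mul_inv]
  congr 1
  field_simp

/-- At positive times, a standard Brownian motion is a scaled standard Gaussian vector. -/
lemma IsBrownian.hasLaw_eval {N : ℕ} {Ω : Type*} [MeasurableSpace Ω] {P : Measure Ω}
    {W : Fin N → ℝ≥0 → Ω → ℝ} (hW : IsBrownian W P) {s : ℝ≥0} (hs : 0 < s) :
    HasLaw (fun ω => (√(s : ℝ))⁻¹ • WithLp.toLp 2 (fun i => W i s ω)) (stdGaussian (E N)) P := by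
  have : IsProbabilityMeasure P := hW.indep.isProbabilityMeasure
  have hlaw : ∀ i, HasLaw (fun ω => (√(s : ℝ))⁻¹ * W i s ω) (gaussianReal 0 1) P := fun i => by
    convert gaussianReal_const_mul ((hW.isBrownianReal i).toIsPreBrownianReal.hasLaw_eval s)
      (√(s : ℝ))⁻¹ using 2
    · simp
    · ext
      have : (s : ℝ) ≠ 0 := by exact_mod_cast hs.ne'
      simp [this]
  have hind : iIndepFun (fun i ω => (√(s : ℝ))⁻¹ * W i s ω) P :=
    hW.indep.comp (fun _ w => (√(s : ℝ))⁻¹ * w s) (fun _ => by fun_prop)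
  have hpi : HasLaw (fun ω i => (√(s : ℝ))⁻¹ * W i s ω)
      (Measure.pi fun _ : Fin N => gaussianReal 0 1) P :=
    ⟨aemeasurable_pi_lambda _ fun i => (hlaw i).aemeasurable, by
      rw [hind.map_fun_eq_pi_map fun i => (hlaw i).aemeasurable]
      simp_rw [fun i => (hlaw i).map_eq]⟩
  exact HasLaw.fun_comp (Y := WithLp.toLp 2) ⟨by fun_prop, map_pi_eq_stdGaussian⟩ hpi

end SphereAndGaussian

/-! ### Boltzmann weights and sampling trajectories. -/

lemma boltzmannWeights_top {K : ℕ} (R : Fin K → ℝ) (k : Fin K) : boltzmannWeights ⊤ R k = 1 := by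
  have hK : (K : ℝ) ≠ 0 := by exact_mod_cast (Fin.pos k).ne'
  simp [boltzmannWeights, hK]

lemma tendsto_boltzmannWeights_atTop {K : ℕ} (R : Fin K → ℝ) :
    Tendsto (fun τ : ℝ => boltzmannWeights (τ : EReal) R) atTop (𝓝 (boltzmannWeights ⊤ R)) := by
  refine tendsto_pi_nhds.2 fun k => ?_
  have hK : (K : ℝ) ≠ 0 := by exact_mod_cast (Fin.pos k).ne'
  have hexp : ∀ j, Tendsto (fun τ : ℝ => Real.exp (R j / τ)) atTop (𝓝 1) := fun j => by
    simpa [Function.comp_def] using (Real.continuous_exp.tendsto 0).comp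
      (tendsto_const_nhds.div_atTop (tendsto_id (α := ℝ)) : Tendsto (fun τ => R j / τ) atTop (𝓝 0))
  have hZ := (tendsto_finsetSum Finset.univ fun j _ => hexp j).const_mul (1 / (K : ℝ))
  have hlim := (hexp k).div hZ (by simp [hK])
  rw [boltzmannWeights_top]
  simpa [boltzmannWeights, ← EReal.coe_div, hK, Pi.div_def] using hlim

/-- Boltzmann Demon sampling at infinite temperature is SDE sampling seeded by the projected sums
of the candidate noises. -/
lemma boltzmannDemon_top {N K : ℕ} (f : E N → ℝ → E N) (g : ℝ → ℝ) (r : E N → ℝ)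
    (c : E N → ℝ → E N) (t : ℕ → ℝ) (x : E N) (z : ℕ → Fin K → E N) :
    boltzmannDemon f g r c ⊤ t x z =
      sdeSampling f g t x (fun i => projSphere (∑ k, z i k)) := by
  funext i
  induction i with
  | zero => rfl
  | succ i ih => simp [boltzmannDemon, sdeSampling, ih, boltzmannNoise, boltzmannWeights_top]

/-- Lets equality in law of noise sequences pass to whole trajectories. -/
lemma measurable_sdeSampling {N : ℕ} {f : E N → ℝ → E N} (hf : ∀ t, Measurable fun x => f x t)
    (g : ℝ → ℝ) (t : ℕ → ℝ) (x : E N) : Measurable (sdeSampling f g t x) := by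
  refine measurable_pi_lambda _ fun i => ?_
  induction i with
  | zero => exact measurable_const
  | succ i ih =>
    have hem : Measurable fun w : ℕ → E N => eulerMaruyama f g (sdeSampling f g t x w i) (w i)
        (t i) (t i - t (i + 1)) := by
      have := (hf (t i)).comp ih
      simp only [Function.comp_def] at this
      unfold eulerMaruyama
      fun_prop
    have h₁ := (hf (t i)).comp ih
    have h₂ := (hf (t i - (t i - t (i + 1)))).comp hem
    simp only [Function.comp_def] at h₁ h₂
    simp only [sdeSampling, heun]
    fun_prop

/-- Both Heun averages collapse for constant coefficients, so each step adds a fixed drift and a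
multiple of its noise. -/
lemma sdeSampling_const {N : ℕ} (a : E N) (σ t δ : ℝ) (x : E N) (w : ℕ → E N) (m : ℕ) :
    sdeSampling (fun _ _ => a) (fun _ => σ) (fun j => t - j * δ) x w m =
      x - (m * δ) • a + (σ * √δ) • ∑ i ∈ Finset.range m, w i := by
  induction m with
  | zero => simp [sdeSampling]
  | succ m ih =>
    have hδ : t - m * δ - (t - (m + 1 : ℕ) * δ) = δ := by push_cast; ring
    simp only [sdeSampling, ih, hδ, heun, Finset.sum_range_succ]
    push_cast
    module

/-- With constant coefficients, `n` steps of size `Δ / n` amount to a single Euler-Maruyama step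
seeded by the normalised sum of the noises. -/
lemma sdeSampling_const_div {N : ℕ} (f : E N → ℝ → E N) (g : ℝ → ℝ) (x : E N) (t : ℝ) {Δ : ℝ}
    (hΔ : 0 < Δ) (w : ℕ → E N) {n : ℕ} (hn : 0 < n) :
    sdeSampling (fun _ _ => f x t) (fun _ => g t) (fun j => t - j * (Δ / n)) x w n =
      eulerMaruyama f g x ((√(n : ℝ))⁻¹ • ∑ i ∈ Finset.range n, w i) t Δ := by
  have hn' : (n : ℝ) ≠ 0 := by exact_mod_cast hn.ne'
  rw [sdeSampling_const, mul_div_cancel₀ _ hn', Real.sqrt_div hΔ.le, eulerMaruyama, smul_smul,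
    div_eq_mul_inv, mul_assoc]

lemma continuous_eulerMaruyama {N : ℕ} (f : E N → ℝ → E N) (g : ℝ → ℝ) (x : E N) (t Δ : ℝ) :
    Continuous fun z => eulerMaruyama f g x z t Δ := by
  unfold eulerMaruyama; fun_prop

theorem mainTheorem4 {N K : ℕ} (hN : 0 < N) (hK : 0 < K)
    -- drift, diffusion coefficient, reward, and denoising map
    (f : E N → ℝ → E N) (hf : ∀ t, Measurable (fun x => f x t)) (g : ℝ → ℝ)
    (r : E N → ℝ) (c : E N → ℝ → E N)
    -- the candidate noises of the Demon: `K` i.i.d. standard Gaussians for every step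
    {Ω : Type*} [MeasurableSpace Ω] (P : Measure Ω) [IsProbabilityMeasure P]
    (z : ℕ → Fin K → Ω → E N) (hz : ∀ i k, HasLaw (z i k) (stdGaussian (E N)) P)
    (hz_indep : iIndepFun (fun p : ℕ × Fin K => z p.1 p.2) P)
    -- the noises of SDE sampling: one standard Gaussian for every step
    {Ω₁ : Type*} [MeasurableSpace Ω₁] (P₁ : Measure Ω₁) [IsProbabilityMeasure P₁]
    (ζ : ℕ → Ω₁ → E N) (hζ : ∀ i, HasLaw (ζ i) (stdGaussian (E N)) P₁)
    (hζ_indep : iIndepFun ζ P₁)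
    -- i.i.d. uniform vectors on the sphere of radius `√N`
    {Ω₂ : Type*} [MeasurableSpace Ω₂] (P₂ : Measure Ω₂) [IsProbabilityMeasure P₂]
    (u : ℕ → Ω₂ → E N) (hu : ∀ i, HasLaw (u i) (uniformSphere N) P₂) (hu_indep : iIndepFun u P₂)
    -- a standard Gaussian vector
    {Ω₃ : Type*} [MeasurableSpace Ω₃] (P₃ : Measure Ω₃) [IsProbabilityMeasure P₃]
    (Z : Ω₃ → E N) (hZ : HasLaw Z (stdGaussian (E N)) P₃)
    -- a standard Brownian motion
    {Ω₄ : Type*} [MeasurableSpace Ω₄] (P₄ : Measure Ω₄) [IsProbabilityMeasure P₄]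
    (W : Fin N → ℝ≥0 → Ω₄ → ℝ) (hW : IsBrownian W P₄) :
    -- at `τ = ∞`, which is the limit `τ → ∞`, all weights are equal to one
    (∀ R : Fin K → ℝ,
      (∀ k, boltzmannWeights ⊤ R k = 1) ∧
      Tendsto (fun τ : ℝ => boltzmannWeights (τ : EReal) R) atTop (𝓝 (boltzmannWeights ⊤ R))) ∧
    -- the sum of `K` i.i.d. Gaussians is `N(0, K I)`; projected, it is uniform on the sphere,
    -- exactly as a single projected Gaussian
    (∀ i, HasLaw (fun ω => ∑ k, z i k ω)
        (multivariateGaussian 0 ((K : ℝ) • (1 : Matrix (Fin N) (Fin N) ℝ))) P ∧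
      HasLaw (fun ω => projSphere (∑ k, z i k ω)) (uniformSphere N) P ∧
      HasLaw (fun ω => projSphere (ζ i ω)) (uniformSphere N) P₁) ∧
    -- for all coefficients and all time grids, the trajectory of Boltzmann Demon sampling with
    -- `τ = ∞` is distributed as that of SDE sampling with projected Gaussian noise, and as that
    -- with uniform noise on the sphere
    (∀ (t : ℕ → ℝ) (x : E N),
      IdentDistrib (fun ω => boltzmannDemon f g r c ⊤ t x (fun i k => z i k ω))
        (fun ω => sdeSampling f g t x (fun i => projSphere (ζ i ω))) P P₁ ∧
      IdentDistrib (fun ω => boltzmannDemon f g r c ⊤ t x (fun i k => z i k ω))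
        (fun ω => sdeSampling f g t x (fun i => u i ω)) P P₂) ∧
    -- central limit theorem for uniform vectors on the sphere
    TendstoInDistribution (fun (n : ℕ) ω => (√(n : ℝ))⁻¹ • ∑ i ∈ Finset.range n, u i ω)
      atTop Z (fun _ => P₂) P₃ ∧
    -- the Euler-Maruyama step with spherical noise converges to the Gaussian step
    (∀ (a : E N) (σ Δ : ℝ), 0 < Δ →
      TendstoInDistribution
        (fun (n : ℕ) ω => -(Δ • a) + ∑ i ∈ Finset.range n, (σ * √(Δ / n)) • u i ω)
        atTop (fun ω => -(Δ • a) + (σ * √Δ) • Z ω) (fun _ => P₂) P₃) ∧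
    -- with the coefficients kept constant over the interval from `t` down to `t - Δ`, Boltzmann
    -- Demon sampling with `τ = ∞` and `n` steps of size `Δ / n` converges, as `n → ∞`, to the
    -- Gaussian Euler-Maruyama step and to the solution of the SDE, which are distributed as the
    -- result of SDE sampling with any number of steps
    (∀ (x : E N) (t Δ : ℝ), 0 < Δ →
      TendstoInDistribution
        (fun (n : ℕ) ω => boltzmannDemon (fun _ _ => f x t) (fun _ => g t) r c ⊤
          (fun j => t - j * (Δ / n)) x (fun i k => z i k ω) n)
        atTop (fun ω => eulerMaruyama f g x (Z ω) t Δ) (fun _ => P) P₃ ∧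
      TendstoInDistribution
        (fun (n : ℕ) ω => boltzmannDemon (fun _ _ => f x t) (fun _ => g t) r c ⊤
          (fun j => t - j * (Δ / n)) x (fun i k => z i k ω) n)
        atTop (constSDE x (f x t) (g t) W Δ.toNNReal) (fun _ => P) P₄ ∧
      ∀ n : ℕ, 0 < n →
        IdentDistrib
          (fun ω => sdeSampling (fun _ _ => f x t) (fun _ => g t)
            (fun j => t - j * (Δ / n)) x (fun i => ζ i ω) n)
          (fun ω => eulerMaruyama f g x (Z ω) t Δ) P₁ P₃ ∧
        IdentDistrib
          (fun ω => sdeSampling (fun _ _ => f x t) (fun _ => g t)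
            (fun j => t - j * (Δ / n)) x (fun i => ζ i ω) n)
          (constSDE x (f x t) (g t) W Δ.toNNReal) P₁ P₄) := by
  have hz_sum : ∀ i, HasLaw (fun ω => (√(K : ℝ))⁻¹ • ∑ k, z i k ω) (stdGaussian (E N)) P := by
    intro i
    have hrow : iIndepFun (z i) P :=
      hz_indep.precomp (g := fun k => (i, k)) (Prod.mk_right_injective i)
    have : (Finset.univ : Finset (Fin K)).Nonempty := ⟨⟨0, hK⟩, Finset.mem_univ _⟩
    simpa using hasLaw_inv_sqrt_card_smul_sum_stdGaussian this (fun k _ => hz i k)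
      (hrow.restrict _)
  have hK' : 0 < (√(K : ℝ))⁻¹ := by positivity
  have hproj : HasLaw projSphere (uniformSphere N) (stdGaussian (E N)) :=
    ⟨measurable_projSphere.aemeasurable, map_projSphere_stdGaussian hN⟩
  have hw : ∀ i, HasLaw (fun ω => projSphere (∑ k, z i k ω)) (uniformSphere N) P := fun i => by
    simpa only [projSphere_smul hK'] using hproj.fun_comp (hz_sum i)
  have hw_indep : iIndepFun (fun i ω => projSphere (∑ k, z i k ω)) P :=
    (iIndepFun.of_uncurry (fun i k => (hz i k).aemeasurable) hz_indep).comp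
      (fun _ v => projSphere (∑ k, v k))
      (fun _ => measurable_projSphere.comp (by fun_prop))
  have hζp : ∀ i, HasLaw (fun ω => projSphere (ζ i ω)) (uniformSphere N) P₁ := fun i =>
    hproj.fun_comp (hζ i)
  have hζp_indep : iIndepFun (fun i ω => projSphere (ζ i ω)) P₁ :=
    hζ_indep.comp (fun _ => projSphere) (fun _ => measurable_projSphere)
  have hclt : TendstoInDistribution (fun (n : ℕ) ω => (√(n : ℝ))⁻¹ • ∑ i ∈ Finset.range n, u i ω)
      atTop Z (fun _ => P₂) P₃ :=
    tendstoInDistribution_inv_sqrt_smul_sum hu hu_indep (integral_inner_uniformSphere hN)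
      (integral_inner_sq_uniformSphere hN) hZ
  refine ⟨fun R => ⟨boltzmannWeights_top R, tendsto_boltzmannWeights_atTop R⟩,
    fun i => ⟨?_, hw i, hζp i⟩, fun t x => ?_, hclt, fun a σ Δ hΔ => ?_, fun x t Δ hΔ => ?_⟩
  · have h := HasLaw.fun_comp (Y := fun v : E N => √(K : ℝ) • v)
      ⟨by fun_prop, map_smul_stdGaussian (Nat.cast_nonneg K)⟩ (hz_sum i)
    simpa only [smul_inv_smul₀ (inv_pos.1 hK').ne'] using h
  · simp only [boltzmannDemon_top]
    -- Independence over the steps upgrades equal marginals to equal laws of the noise sequences.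
    exact ⟨(IdentDistrib.pi (fun i => (hw i).identDistrib (hζp i)) hw_indep hζp_indep).comp
        (measurable_sdeSampling hf g t x),
      (IdentDistrib.pi (fun i => (hw i).identDistrib (hu i)) hw_indep hu_indep).comp
        (measurable_sdeSampling hf g t x)⟩
  · have h := hclt.continuous_comp (g := fun v : E N => -(Δ • a) + (σ * √Δ) • v) (by fun_prop)
    refine h.congr (fun n => ae_of_all _ fun ω => ?_) ae_eq_rfl
    simp only [Function.comp_apply]
    rw [← Finset.smul_sum, Real.sqrt_div hΔ.le, smul_smul, div_eq_mul_inv, mul_assoc]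
  · have hEM := continuous_eulerMaruyama f g x t Δ
    have hWlaw := hW.hasLaw_eval (Real.toNNReal_pos.2 hΔ)
    have hsde : constSDE x (f x t) (g t) W Δ.toNNReal = fun ω => eulerMaruyama f g x
        ((√(Δ.toNNReal : ℝ))⁻¹ • WithLp.toLp 2 (fun i => W i Δ.toNNReal ω)) t Δ := by
      funext ω
      have : √Δ ≠ 0 := (Real.sqrt_pos.2 hΔ).ne'
      simp only [constSDE, eulerMaruyama, Real.coe_toNNReal _ hΔ.le, smul_smul]
      rw [mul_inv_cancel_right₀ this]
    have hlimits : IdentDistrib (fun ω => eulerMaruyama f g x (Z ω) t Δ)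
        (constSDE x (f x t) (g t) W Δ.toNNReal) P₃ P₄ := by
      rw [hsde]
      exact (hZ.identDistrib hWlaw).comp hEM.measurable
    have htendsto : TendstoInDistribution
        (fun (n : ℕ) ω => boltzmannDemon (fun _ _ => f x t) (fun _ => g t) r c ⊤
          (fun j => t - j * (Δ / n)) x (fun i k => z i k ω) n)
        atTop (fun ω => eulerMaruyama f g x (Z ω) t Δ) (fun _ => P) P₃ := by
      simp only [boltzmannDemon_top]
      refine ((tendstoInDistribution_inv_sqrt_smul_sum hw hw_indep
        (integral_inner_uniformSphere hN) (integral_inner_sq_uniformSphere hN)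
        hZ).continuous_comp hEM).congr_eventually (fun n => ?_) ?_
      · exact ((measurable_pi_apply n).comp (measurable_sdeSampling (fun _ => measurable_const)
          (fun _ => g t) _ x)).comp_aemeasurable
          (aemeasurable_pi_lambda _ fun i => (hw i).aemeasurable)
      -- `n = 0` is excluded: the sampler then stays at `x`, while the Euler-Maruyama expression
      -- still contains the drift.
      · filter_upwards [eventually_gt_atTop 0] with n hn
        funext ω
        exact (sdeSampling_const_div f g x t hΔ _ hn).symm
    refine ⟨htendsto, htendsto.of_identDistrib_limit hlimits, fun n hn => ?_⟩
    have hstep : IdentDistrib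
        (fun ω => sdeSampling (fun _ _ => f x t) (fun _ => g t)
          (fun j => t - j * (Δ / n)) x (fun i => ζ i ω) n)
        (fun ω => eulerMaruyama f g x (Z ω) t Δ) P₁ P₃ := by
      simp only [sdeSampling_const_div f g x t hΔ _ hn]
      have hsum := hasLaw_inv_sqrt_card_smul_sum_stdGaussian
        (Finset.nonempty_range_iff.2 hn.ne') (fun i _ => hζ i) (hζ_indep.restrict _)
      rw [Finset.card_range] at hsum
      exact (hsum.identDistrib hZ).comp hEM.measurable
    exact ⟨hstep, hstep.trans hlimits⟩
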